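/- Let $Y$ be a finite dimensional Euclidean space, $K\subseteq Y$ a (nonempty) closed convex cone with dual cone $K^*=\{y : \langle y,x\rangle\ge 0\ \forall x\in K\}$, and $A:\mathbb R^m\to Y$ a linear map with adjoint $A^*$, range $\mathcal R(A)$, and $\mathcal N(A^*)$ the null space of $A^*$. For a set $C\subseteq Y$ let $\operatorname{lin}C$ be its linear span and $C^\perp$ the orthogonal complement of $\operatorname{lin} C$. For a closed convex cone $C$ let $\operatorname{FR}_k(C)$ be the set of tuples $(y_1,\dots,y_k)$ in $Y$ with $y_i\in(C\cap y_1^\perp\cap\dots\cap y_{i-1}^\perp)^*$ for $i=1,\dots,k$. A face of $K$ is a convex subset $F\subseteq K$ such that $y,z\in K$ and $\frac12(y+z)\in F$ imply $y,z\in F$; it is exposed if $F=K\cap y^\perp$ for some $y\in K^*$. For integers $k,\ell\ge 1$, the nonclosedness of $A^*K^*$ is said to have a $(k+1,\ell+1)$-proof if there are $(a_1,\dots,a_{k+1})\in\operatorname{FR}_{k+1}(K^*)$ and $(y_1,\dots,y_{\ell+1})\in\operatorname{FR}_{\ell+1}(K)$ such that $a_i\in\mathcal R(A)$ for $i\le k+1$,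 $y_j\in\mathcal N(A^*)$ for $j\le \ell$, $\langle a_i,y_{\ell+1}\rangle=0$ for $i\le k$, and $\langle a_{k+1},y_{\ell+1}\rangle=-1$. For a face $F$ of $K$, the nonclosedness of $K^*+F^\perp$ is said to have a $(k+1,\ell+1)$-proof if there are such tuples with $\mathcal R(A)$ replaced by $\operatorname{lin}F$ and $\mathcal N(A^*)$ replaced by $F^\perp$. For an affine subspace $H$ with $H\cap K\neq\emptyset$, the minimal cone of $H\cap K$ is the intersection of all faces of $K$ containing $H\cap K$. The facial reduction algorithm starts with $F_0=K$ and in step $i\geq 1$ chooses some $y_i\in H^\perp\cap(F_{i-1}^*\setminus F_{i-1}^\perp)$ and sets $F_i=F_{i-1}\cap y_i^\perp$; the singularity degree of $H\cap K$ is the minimum number of steps in which this algorithm can reach the minimal cone of $H\cap K$. Let $\operatorname{dir}(z,K)=\{y : z+\varepsilon y\in K\text{ for some }\varepsilon>0\}$. Then the following hold. (1) Let $z$ be in the relative interior of $\mathcal R(A)\cap K$, suppose that the condition $\mathcal R(A)\cap(\operatorname{cl}\operatorname{dir}(z,K)\setminus\operatorname{dir}(z,K))=\emptyset$ is violated, and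 let $\ell$ be the singularity degree of $\mathcal R(A)\cap K$. Then $A^*K^*$ is not closed, and its nonclosedness has a $(2,\ell+1)$-proof. (2) Let $G$ be a nonempty face of $K$ that is not exposed. Then there is a smallest exposed face $F$ of $K$ containing $G$, the set $K^*+F^\perp$ is not closed, and its nonclosedness has a $(2,2)$-proof. -/

import Mathlib

open scoped InnerProductSpace Pointwise

namespace ConicLP

variable {Y : Type*} [NormedAddCommGroup Y] [InnerProductSpace ℝ Y] [FiniteDimensional ℝ Y]

/-- The set `K ∩ y₁^⊥ ∩ ⋯ ∩ yᵢ^⊥` cut out of `K` by the first `i` vectors of a tuple `y`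
(the vectors `y j` are indexed from `0`, so the first `i` are those with `j < i`). -/
def cutFace (K : Set Y) {k : ℕ} (y : Fin k → Y) (i : ℕ) : Set Y :=
  {x | x ∈ K ∧ ∀ j : Fin k, (j : ℕ) < i → ⟪y j, x⟫_ℝ = 0}

/-- The order `k` facial reduction cone `FR_k(K)`: tuples `(y₁, …, y_k)` with
`yᵢ ∈ (K ∩ y₁^⊥ ∩ ⋯ ∩ yᵢ₋₁^⊥)^*` for all `i` (in particular `y₁ ∈ K^*`). -/
def facialReductionCone (k : ℕ) (K : Set Y) : Set (Fin k → Y) :=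
  {y | ∀ i : Fin k, y i ∈ ProperCone.innerDual (cutFace K y i)}

/-- `F` is a face of `K`: a convex subset of `K` such that `y, z ∈ K` and `(y + z) / 2 ∈ F`
imply `y, z ∈ F`. (The empty set is a face in this sense.) -/
structure IsFace (F K : Set Y) : Prop where
  subset : F ⊆ K
  convex : Convex ℝ F
  mem_of_midpoint_mem : ∀ y ∈ K, ∀ z ∈ K, (1 / 2 : ℝ) • (y + z) ∈ F → y ∈ F ∧ z ∈ F

/-- `F` is an exposed face of `K`: a face of the form `K ∩ y^⊥` with `y ∈ K^*`. -/
def IsExposedFace (F K : Set Y) : Prop :=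
  IsFace F K ∧ ∃ y ∈ ProperCone.innerDual K, F = {x | x ∈ K ∧ ⟪y, x⟫_ℝ = 0}

/-- The minimal cone of `H ∩ K`: the intersection of all faces of `K` that contain `H ∩ K`. -/
def minimalCone (H : AffineSubspace ℝ Y) (K : Set Y) : Set Y :=
  ⋂₀ {G | IsFace G K ∧ (H : Set Y) ∩ K ⊆ G}

/-- `(y₁, …, y_k)` are the vectors chosen in `k` steps of the facial reduction algorithm for
`H ∩ K`: with `F₀ = K` and `Fᵢ = Fᵢ₋₁ ∩ yᵢ^⊥`, each `yᵢ` lies in `H^⊥ ∩ (Fᵢ₋₁^* \ Fᵢ₋₁^⊥)`.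
Here `C^⊥` is the orthogonal complement of the linear span of `C`. -/
def IsFacialReduction (H : AffineSubspace ℝ Y) (K : Set Y) {k : ℕ} (y : Fin k → Y) : Prop :=
  ∀ i : Fin k, y i ∈ (Submodule.span ℝ (H : Set Y))ᗮ ∧
    y i ∈ ProperCone.innerDual (cutFace K y i) ∧ y i ∉ (Submodule.span ℝ (cutFace K y i))ᗮ

/-- The singularity degree of `H ∩ K`: the least number of steps in which the facial reduction
algorithm can reach the minimal cone of `H ∩ K`. -/
noncomputable def singularityDegree (H : AffineSubspace ℝ Y) (K : Set Y) : ℕ :=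
  sInf {k | ∃ y : Fin k → Y, IsFacialReduction H K y ∧ cutFace K y k = minimalCone H K}

/-- The set `dir(z, K)` of feasible directions at `z` in `K`. -/
def feasibleDirections (z : Y) (K : Set Y) : Set Y :=
  {y | ∃ ε : ℝ, 0 < ε ∧ z + ε • y ∈ K}

/-- The nonclosedness of `A^* K^*` has a `(k+1, ℓ+1)`-proof (`k, ℓ ≥ 1`). -/
def HasImageNonclosedProof {m : ℕ}
    (A : EuclideanSpace ℝ (Fin m) →ₗ[ℝ] Y) (K : Set Y) (k l : ℕ) : Prop :=
  1 ≤ k ∧ 1 ≤ l ∧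
    ∃ a ∈ facialReductionCone (k + 1) (ProperCone.innerDual K : Set Y),
    ∃ y ∈ facialReductionCone (l + 1) K,
      (∀ i : Fin (k + 1), a i ∈ LinearMap.range A) ∧
      (∀ j : Fin l, y j.castSucc ∈ LinearMap.ker (LinearMap.adjoint A)) ∧
      (∀ i : Fin k, ⟪a i.castSucc, y (Fin.last l)⟫_ℝ = 0) ∧
      ⟪a (Fin.last k), y (Fin.last l)⟫_ℝ = -1

/-- The nonclosedness of `K^* + F^⊥` has a `(k+1, ℓ+1)`-proof (`k, ℓ ≥ 1`). -/
def HasSumNonclosedProof (F K : Set Y) (k l : ℕ) : Prop :=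
  1 ≤ k ∧ 1 ≤ l ∧
    ∃ a ∈ facialReductionCone (k + 1) (ProperCone.innerDual K : Set Y),
    ∃ y ∈ facialReductionCone (l + 1) K,
      (∀ i : Fin (k + 1), a i ∈ Submodule.span ℝ F) ∧
      (∀ j : Fin l, y j.castSucc ∈ (Submodule.span ℝ F)ᗮ) ∧
      (∀ i : Fin k, ⟪a i.castSucc, y (Fin.last l)⟫_ℝ = 0) ∧
      ⟪a (Fin.last k), y (Fin.last l)⟫_ℝ = -1

end ConicLP

/-!
Both parts rest on one theorem of the alternative (`exists_add_mem_of_orthogonal`): for a subspace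
`R` and a convex cone `C`, either some `y ∈ R^⊥ ∩ C^*` does not vanish on `C`, or every point of `C`
can be moved into `R` by adding a point of `C`. It follows from the fact that the convex cone
`R + C + (R + lin C)^⊥` is dense, hence everything, as soon as its dual cone is trivial.

For the image `A^* K^*`, let `z` be in the relative interior of `R(A) ∩ K`. The minimal cone is the
face generated by `z` (`generatedFace`), and the alternative shows that facial reduction reaches it;
so the singularity degree `ℓ` is attained by some `y₁, …, y_ℓ`. A direction `v` in the closure of
`dir(z, K)` but not in `dir(z, K)` lies outside the span of the minimal cone, so there is `w`
orthogonal to the minimal cone with `⟨v, w⟩ = -1`. Then `(z, v)` and `(y₁, …, y_ℓ, w)` form the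
proof. Farkas' lemma puts `A^* w` in the closure of `A^* K^*`, while `A^* w = A^* u` with `u ∈ K^*`
would give `⟨z, u⟩ = 0`, hence `⟨v, u⟩ ≥ 0`, against `⟨v, u⟩ = ⟨v, w⟩ = -1`.

For a nonexposed face `G`, take `g` in its relative interior and `y` in the relative interior of
`K^* ∩ g^⊥`. The smallest exposed face containing `G` is `F = K ∩ y^⊥`, and all of `K^* ∩ g^⊥`
vanishes on `F`. As `F ≠ G`, the alternative for `ℝg` and `F` gives `w ∈ F^* ∩ g^⊥` with
`⟨x, w⟩ > 0` for some `x ∈ F`. The pairs `(g, -x / ⟨x, w⟩)` and `(y, w)` form the proof, and `w` lies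
in the closure of `K^* + F^⊥` but not in that set.
-/

namespace ConicLP

variable {Y : Type*} [NormedAddCommGroup Y] [InnerProductSpace ℝ Y]

/-! ### Convex cones and the theorem of the alternative -/

/-- A point in the relative interior of `s` can be moved a little further away from any other
point of `s`. -/
lemma exists_add_smul_sub_mem {s : Set Y} {x z : Y} (hz : z ∈ intrinsicInterior ℝ s)
    (hx : x ∈ s) : ∃ ε : ℝ, 0 < ε ∧ z + ε • (z - x) ∈ s := by
  obtain ⟨p, hp, rfl⟩ := mem_intrinsicInterior.1 hz
  obtain ⟨U, hU, hUs⟩ := isOpen_induced_iff.1 (isOpen_interior (s := ((↑) ⁻¹' s :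
    Set (affineSpan ℝ s))))
  have hline : ∀ t : ℝ, (p : Y) + t • ((p : Y) - x) ∈ affineSpan ℝ s := by
    intro t
    have := AffineMap.lineMap_mem (-t) p.2 (subset_affineSpan ℝ s hx)
    rw [AffineMap.lineMap_apply_module'] at this
    convert this using 1
    module
  have hcont : Continuous fun t : ℝ => (p : Y) + t • ((p : Y) - x) := by fun_prop
  have h0 : (fun t : ℝ => (p : Y) + t • ((p : Y) - x)) ⁻¹' U ∈ nhds 0 := by
    refine hcont.continuousAt.preimage_mem_nhds (hU.mem_nhds ?_)
    have : p ∈ ((↑) ⁻¹' U : Set (affineSpan ℝ s)) := hUs ▸ hp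
    simpa using this
  obtain ⟨ε, hε, hball⟩ := Metric.mem_nhds_iff.1 h0
  refine ⟨ε / 2, by positivity, ?_⟩
  have hmem : (p : Y) + (ε / 2) • ((p : Y) - x) ∈ U :=
    hball (by simp [abs_of_pos hε, hε])
  have : (⟨_, hline (ε / 2)⟩ : affineSpan ℝ s) ∈ ((↑) ⁻¹' U : Set (affineSpan ℝ s)) := hmem
  rw [hUs] at this
  exact interior_subset (s := ((↑) ⁻¹' s : Set (affineSpan ℝ s))) this

/-- A convex set that is dense in a finite dimensional space is the whole space. -/
lemma eq_univ_of_convex_of_dense [FiniteDimensional ℝ Y] {s : Set Y} (hs : Convex ℝ s)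
    (hd : Dense s) : s = Set.univ := by
  have hspan : affineSpan ℝ s = ⊤ := by
    have hcl : IsClosed (affineSpan ℝ s : Set Y) := AffineSubspace.closed_of_finiteDimensional _
    have h1 : closure s ⊆ (affineSpan ℝ s : Set Y) :=
      closure_minimal (subset_affineSpan ℝ s) hcl
    rw [hd.closure_eq] at h1
    exact SetLike.coe_injective (Set.univ_subset_iff.1 h1)
  have hne := hs.interior_nonempty_iff_affineSpan_eq_top.2 hspan
  have hint := hs.interior_closure_eq_interior_of_nonempty_interior hne
  rw [hd.closure_eq, interior_univ] at hint
  exact Set.univ_subset_iff.1 (hint ▸ interior_subset)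

/-- A convex cone whose dual cone is trivial is the whole space; no closedness is needed. -/
lemma eq_top_of_dual_trivial [FiniteDimensional ℝ Y] (D : PointedCone ℝ Y)
    (h : ∀ y : Y, (∀ x ∈ D, 0 ≤ ⟪x, y⟫_ℝ) → y = 0) : D = ⊤ := by
  have hd : Dense (D : Set Y) := by
    rw [dense_iff_closure_eq, ← Set.univ_subset_iff]
    intro x _
    by_contra hx
    have hx' : x ∉ Submodule.closure D := hx
    obtain ⟨y, hy, hxy⟩ := ProperCone.hyperplane_separation' (Submodule.closure D) hx'
    have := h y fun x hx => hy x (subset_closure hx)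
    simp [this] at hxy
  exact SetLike.coe_injective (eq_univ_of_convex_of_dense D.convex hd)

lemma mem_orthogonal_span {s : Set Y} {y : Y} :
    y ∈ (Submodule.span ℝ s)ᗮ ↔ ∀ x ∈ s, ⟪x, y⟫_ℝ = 0 := by
  refine ⟨fun h x hx => Submodule.inner_right_of_mem_orthogonal (Submodule.subset_span hx) h,
    fun h => ?_⟩
  rw [Submodule.mem_orthogonal]
  intro u hu
  induction hu using Submodule.span_induction with
  | mem u hu => exact h u hu
  | zero => simp
  | add a b _ _ ha hb => rw [inner_add_left, ha, hb, add_zero]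
  | smul t a _ ha => rw [inner_smul_left, ha, mul_zero]

/-- Theorem of the alternative behind facial reduction: if every vector of `C^*` that is orthogonal
to the subspace `R` is already orthogonal to `C`, then every point of `C` can be moved into `R`
within `C`. -/
lemma exists_add_mem_of_orthogonal [FiniteDimensional ℝ Y] (R : Submodule ℝ Y)
    (C : PointedCone ℝ Y)
    (h : ∀ y ∈ Rᗮ, (∀ x ∈ C, 0 ≤ ⟪x, y⟫_ℝ) → ∀ x ∈ C, ⟪x, y⟫_ℝ = 0) {x : Y} (hx : x ∈ C) :
    ∃ f ∈ C, x + f ∈ R := by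
  -- The third summand makes the cone full-dimensional, so that density gives everything.
  set V : Submodule ℝ Y := R ⊔ Submodule.span ℝ (C : Set Y) with hV
  set D : PointedCone ℝ Y := ((R : PointedCone ℝ Y) ⊔ C) ⊔ (Vᗮ : Submodule ℝ Y) with hD
  have hRD : ∀ r ∈ R, r ∈ D := fun r hr => Submodule.mem_sup_left (Submodule.mem_sup_left hr)
  have hCD : ∀ c ∈ C, c ∈ D := fun c hc => Submodule.mem_sup_left (Submodule.mem_sup_right hc)
  have hVD : ∀ v ∈ Vᗮ, v ∈ D := fun v hv => Submodule.mem_sup_right hv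
  have htop : D = ⊤ := by
    refine eq_top_of_dual_trivial D fun y hy => ?_
    have hyR : y ∈ Rᗮ := by
      rw [Submodule.mem_orthogonal]
      intro r hr
      have h1 := hy r (hRD r hr)
      have h2 := hy (-r) (hRD _ (R.neg_mem hr))
      rw [inner_neg_left] at h2
      linarith
    have hyC := h y hyR fun c hc => hy c (hCD c hc)
    have hyV : y ∈ Vᗮ := by
      rw [hV, ← Submodule.inf_orthogonal]
      exact ⟨hyR, mem_orthogonal_span.2 hyC⟩
    have h3 := hy (-y) (hVD _ (Submodule.neg_mem _ hyV))
    rw [inner_neg_left] at h3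
    exact real_inner_self_nonpos.1 (by linarith)
  have hmem : -x ∈ D := htop ▸ Submodule.mem_top
  obtain ⟨a, ha, u, hu, hau⟩ := Submodule.mem_sup.1 hmem
  obtain ⟨r, hr, f, hf, rfl⟩ := Submodule.mem_sup.1 ha
  have hu' : u ∈ Vᗮ := hu
  have hr' : r ∈ R := hr
  have huV : u ∈ V := by
    have : u = -x - r - f := by rw [← hau]; abel
    rw [this]
    have hsp : ∀ c ∈ C, c ∈ V := fun c hc =>
      Submodule.mem_sup_right (Submodule.subset_span hc)
    exact V.sub_mem (V.sub_mem (V.neg_mem (hsp x hx)) (Submodule.mem_sup_left hr')) (hsp f hf)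
  have hu0 : u = 0 := by
    have := Submodule.inner_right_of_mem_orthogonal huV hu'
    exact inner_self_eq_zero.1 this
  refine ⟨f, hf, ?_⟩
  have : x + f = -r := by
    rw [hu0, add_zero] at hau
    rw [← neg_neg x, ← hau]; abel
  rw [this]
  exact R.neg_mem hr'

lemma exists_sub_of_mem_span (C : PointedCone ℝ Y) {v : Y}
    (hv : v ∈ Submodule.span ℝ (C : Set Y)) : ∃ p ∈ C, ∃ q ∈ C, v = p - q := by
  induction hv using Submodule.span_induction with
  | mem x hx => exact ⟨x, hx, 0, C.zero_mem, by simp⟩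
  | zero => exact ⟨0, C.zero_mem, 0, C.zero_mem, by simp⟩
  | add a b _ _ ha hb =>
    obtain ⟨p, hp, q, hq, rfl⟩ := ha
    obtain ⟨p', hp', q', hq', rfl⟩ := hb
    exact ⟨p + p', C.add_mem hp hp', q + q', C.add_mem hq hq', by abel⟩
  | smul t a _ ha =>
    obtain ⟨p, hp, q, hq, rfl⟩ := ha
    rcases le_total 0 t with ht | ht
    · exact ⟨t • p, C.smul_mem ht hp, t • q, C.smul_mem ht hq, smul_sub _ _ _⟩
    · refine ⟨(-t) • q, C.smul_mem (neg_nonneg.2 ht) hq, (-t) • p,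
        C.smul_mem (neg_nonneg.2 ht) hp, ?_⟩
      module

/-- A vector outside a subspace is separated from it by a functional with the normalization used
in nonclosedness proofs. -/
lemma exists_orthogonal_inner_eq_neg_one [FiniteDimensional ℝ Y] {S : Submodule ℝ Y} {v : Y}
    (hv : v ∉ S) : ∃ w ∈ Sᗮ, ⟪v, w⟫_ℝ = -1 := by
  have h : ∃ w ∈ Sᗮ, ⟪v, w⟫_ℝ ≠ 0 := by
    by_contra! h
    refine hv ?_
    rw [← Submodule.orthogonal_orthogonal S, Submodule.mem_orthogonal']
    exact h
  obtain ⟨w, hw, hvw⟩ := h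
  refine ⟨(-(⟪v, w⟫_ℝ)⁻¹) • w, Submodule.smul_mem _ _ hw, ?_⟩
  rw [inner_smul_right]
  field_simp

/-! ### Faces of a closed convex cone -/

/-- The face of `K` generated by `z ∈ K`: the points of `K` dominated by a multiple of `z`.
It is a cone for every `z`, and the smallest face of `K` that contains `z` when `z ∈ K`. -/
def generatedFace (K : ProperCone ℝ Y) (z : Y) : PointedCone ℝ Y where
  carrier := {x | x ∈ K ∧ ∃ t : ℝ, 0 ≤ t ∧ t • z - x ∈ K}
  zero_mem' := ⟨K.zero_mem, 0, le_rfl, by simp⟩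
  add_mem' := by
    rintro a b ⟨ha, s, hs, hs'⟩ ⟨hb, t, ht, ht'⟩
    refine ⟨K.add_mem ha hb, s + t, add_nonneg hs ht, ?_⟩
    have e : (s + t) • z - (a + b) = (s • z - a) + (t • z - b) := by module
    rw [e]
    exact K.add_mem hs' ht'
  smul_mem' := by
    rintro ⟨c, hc⟩ a ⟨ha, s, hs, hs'⟩
    refine ⟨K.smul_mem ha hc, c * s, mul_nonneg hc hs, ?_⟩
    have e : (c * s) • z - c • a = c • (s • z - a) := by module
    change (c * s) • z - c • a ∈ K
    rw [e]
    exact K.smul_mem hs' hc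

lemma self_mem_generatedFace {K : ProperCone ℝ Y} {z : Y} (hz : z ∈ K) :
    z ∈ generatedFace K z := ⟨hz, 1, zero_le_one, by simp⟩

lemma mem_generatedFace_of_add_mem {K : ProperCone ℝ Y} {x y z : Y} (hx : x ∈ K) (hy : y ∈ K)
    (h : x + y ∈ generatedFace K z) : x ∈ generatedFace K z := by
  obtain ⟨_, t, ht, ht'⟩ := h
  refine ⟨hx, t, ht, ?_⟩
  have e : t • z - x = t • z - (x + y) + y := by abel
  rw [e]
  exact K.add_mem ht' hy

lemma isFace_generatedFace (K : ProperCone ℝ Y) (z : Y) :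
    IsFace (generatedFace K z : Set Y) (K : Set Y) where
  subset _ hx := hx.1
  convex := (generatedFace K z).convex
  mem_of_midpoint_mem a ha b hb h := by
    have h2 : a + b ∈ generatedFace K z := by
      convert (generatedFace K z).smul_mem zero_le_two h using 1
      module
    exact ⟨mem_generatedFace_of_add_mem ha hb h2,
      mem_generatedFace_of_add_mem hb ha (add_comm a b ▸ h2)⟩

/-- A face of a convex cone is closed under nonnegative multiples. -/
lemma IsFace.smul_mem {K : ProperCone ℝ Y} {G : Set Y} (hG : IsFace G (K : Set Y)) {g : Y}
    (hg : g ∈ G) {t : ℝ} (ht : 0 ≤ t) : t • g ∈ G := by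
  -- `g` is the midpoint of `0` and `2g`.
  have key : ∀ g ∈ G, (0 : Y) ∈ G ∧ (2 : ℝ) • g ∈ G := fun g hg =>
    hG.mem_of_midpoint_mem 0 K.zero_mem _ (K.smul_mem (hG.subset hg) zero_le_two)
      (by convert hg using 1; module)
  have hpow : ∀ n : ℕ, (2 : ℝ) ^ n • g ∈ G := by
    intro n
    induction n with
    | zero => simpa using hg
    | succ n ih => rw [pow_succ', mul_smul]; exact (key _ ih).2
  obtain ⟨n, hn⟩ := pow_unbounded_of_one_lt t (one_lt_two (α := ℝ))
  have h2 : (0 : ℝ) < 2 ^ n := by positivity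
  have := hG.convex.smul_mem_of_zero_mem (key g hg).1 (hpow n)
    (t := t / 2 ^ n) ⟨by positivity, (div_le_one h2).2 hn.le⟩
  rwa [smul_smul, div_mul_cancel₀ _ h2.ne'] at this

lemma IsFace.generatedFace_subset {K : ProperCone ℝ Y} {G : Set Y} (hG : IsFace G (K : Set Y))
    {z : Y} (hz : z ∈ G) : (generatedFace K z : Set Y) ⊆ G := by
  rintro x ⟨hx, t, ht, hxt⟩
  have h := hG.mem_of_midpoint_mem _ (K.smul_mem hx zero_le_two) _ (K.smul_mem hxt zero_le_two)
    (by convert hG.smul_mem hz ht using 1; module)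
  convert hG.smul_mem h.1 (t := 1 / 2) (by norm_num) using 1
  module

lemma subset_generatedFace {K : ProperCone ℝ Y} {S : Set Y} (hS : S ⊆ (K : Set Y)) {z : Y}
    (hz : z ∈ intrinsicInterior ℝ S) : S ⊆ (generatedFace K z : Set Y) := by
  intro x hx
  obtain ⟨ε, hε, h⟩ := exists_add_smul_sub_mem hz hx
  refine ⟨hS hx, (1 + ε) / ε, by positivity, ?_⟩
  convert K.smul_mem (hS h) (inv_nonneg.2 hε.le) using 1
  have h1 : (1 + ε) / ε = ε⁻¹ + 1 := by field_simp
  have h2 : x = (ε⁻¹ * ε) • x := by rw [inv_mul_cancel₀ hε.ne', one_smul]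
  have h3 : (ε⁻¹ * ε) • z = z := by rw [inv_mul_cancel₀ hε.ne', one_smul]
  rw [h1, add_smul, one_smul, smul_add, smul_smul, smul_sub, ← h2, h3]
  abel

lemma minimalCone_eq_generatedFace {K : ProperCone ℝ Y} {H : AffineSubspace ℝ Y} {z : Y}
    (hz : z ∈ intrinsicInterior ℝ ((H : Set Y) ∩ (K : Set Y))) :
    minimalCone H (K : Set Y) = generatedFace K z := by
  refine Set.Subset.antisymm (Set.sInter_subset_of_mem
    ⟨isFace_generatedFace K z, subset_generatedFace Set.inter_subset_right hz⟩) ?_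
  refine Set.subset_sInter fun G hG => hG.1.generatedFace_subset (hG.2 ?_)
  exact intrinsicInterior_subset hz

lemma mem_feasibleDirections_of_mem_span {K : ProperCone ℝ Y} {v z : Y} (hz : z ∈ K)
    (hv : v ∈ Submodule.span ℝ (generatedFace K z : Set Y)) :
    v ∈ feasibleDirections z (K : Set Y) := by
  obtain ⟨p, hp, q, ⟨_, t, ht, hqt⟩, rfl⟩ := exists_sub_of_mem_span _ hv
  refine ⟨(t + 1)⁻¹, by positivity, ?_⟩
  have h1 : z = ((t + 1)⁻¹ * (t + 1)) • z := by rw [inv_mul_cancel₀ (by positivity), one_smul]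
  have h2 : z + (t + 1)⁻¹ • (p - q) = (t + 1)⁻¹ • (z + (t • z - q + p)) := by
    nth_rewrite 1 [h1]
    module
  rw [h2]
  exact K.smul_mem (K.add_mem hz (K.add_mem hqt hp.1)) (by positivity)

/-- Directions in the closure of `dir(z, K)` belong to the dual cone of `K^* ∩ z^⊥`. -/
lemma inner_nonneg_of_mem_closure_feasibleDirections {K : Set Y} {u v z : Y}
    (hv : v ∈ closure (feasibleDirections z K)) (hu : ∀ x ∈ K, 0 ≤ ⟪x, u⟫_ℝ)
    (huz : ⟪z, u⟫_ℝ = 0) : 0 ≤ ⟪v, u⟫_ℝ := by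
  have hcl : IsClosed {d : Y | 0 ≤ ⟪d, u⟫_ℝ} :=
    isClosed_le continuous_const (continuous_id.inner continuous_const)
  refine closure_minimal (s := feasibleDirections z K) ?_ hcl hv
  rintro d ⟨ε, hε, hd⟩
  have := hu _ hd
  rw [inner_add_left, huz, zero_add, real_inner_smul_left] at this
  exact nonneg_of_mul_nonneg_right this hε

/-! ### Facial reduction -/

/-- `cutFace K y i` as a convex cone. -/
def cutCone (K : ProperCone ℝ Y) {k : ℕ} (y : Fin k → Y) (i : ℕ) : PointedCone ℝ Y where
  carrier := cutFace (K : Set Y) y i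
  zero_mem' := ⟨K.zero_mem, by simp⟩
  add_mem' := fun ha hb => ⟨K.add_mem ha.1 hb.1, fun j hj => by
    rw [inner_add_right, ha.2 j hj, hb.2 j hj, add_zero]⟩
  smul_mem' := fun c _ ha => ⟨K.smul_mem ha.1 c.2, fun j hj => by
    change ⟪y j, (c : ℝ) • _⟫_ℝ = 0
    rw [inner_smul_right, ha.2 j hj, mul_zero]⟩

lemma cutFace_zero (K : Set Y) {k : ℕ} (y : Fin k → Y) : cutFace K y 0 = K := by
  simp [cutFace]

lemma mem_cutFace_succ {K : Set Y} {k : ℕ} {y : Fin k → Y} {i : ℕ} (hi : i < k) {x : Y} :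
    x ∈ cutFace K y (i + 1) ↔ x ∈ cutFace K y i ∧ ⟪y ⟨i, hi⟩, x⟫_ℝ = 0 := by
  refine ⟨fun h => ⟨⟨h.1, fun j hj => h.2 j (by omega)⟩, h.2 _ (by simp)⟩, ?_⟩
  rintro ⟨h, h'⟩
  refine ⟨h.1, fun j hj => ?_⟩
  rcases Nat.lt_succ_iff_lt_or_eq.1 hj with hj | hj
  · exact h.2 j hj
  · rwa [show j = ⟨i, hi⟩ from Fin.ext hj]

lemma cutFace_snoc (K : Set Y) {k : ℕ} (y : Fin k → Y) (w : Y) {i : ℕ} (hi : i ≤ k) :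
    cutFace K (Fin.snoc y w : Fin (k + 1) → Y) i = cutFace K y i := by
  ext x
  refine and_congr_right fun _ => ⟨fun h j hj => ?_, fun h j => ?_⟩
  · simpa using h j.castSucc hj
  · refine Fin.lastCases (fun hj => ?_) (fun j hj => ?_) j
    · simp at hj
      omega
    · simpa using h j hj

variable [FiniteDimensional ℝ Y]

lemma isFace_cutFace {K : ProperCone ℝ Y} {k : ℕ} {y : Fin k → Y}
    (hy : y ∈ facialReductionCone k (K : Set Y)) {i : ℕ} (hi : i ≤ k) :
    IsFace (cutFace (K : Set Y) y i) (K : Set Y) := by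
  induction i with
  | zero =>
    rw [cutFace_zero]
    exact ⟨subset_rfl, K.convex, fun a ha b hb _ => ⟨ha, hb⟩⟩
  | succ i ih =>
    have ih := ih (by omega)
    refine ⟨fun x hx => hx.1, (cutCone K y (i + 1)).convex, fun a ha b hb hab => ?_⟩
    rw [mem_cutFace_succ hi] at hab
    obtain ⟨ha', hb'⟩ := ih.mem_of_midpoint_mem a ha b hb hab.1
    have hd := hy ⟨i, hi⟩
    have h1 := hd ha'
    have h2 := hd hb'
    have h3 := hab.2
    simp only [innerₗ_apply_apply] at h1 h2
    rw [inner_smul_right, inner_add_right, real_inner_comm a, real_inner_comm b] at h3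
    rw [mem_cutFace_succ hi, mem_cutFace_succ hi, real_inner_comm a, real_inner_comm b]
    exact ⟨⟨ha', by linarith⟩, hb', by linarith⟩

lemma snoc_mem_facialReductionCone {K : Set Y} {k : ℕ} {y : Fin k → Y}
    (hy : y ∈ facialReductionCone k K) {w : Y}
    (hw : w ∈ ProperCone.innerDual (cutFace K y k)) :
    (Fin.snoc y w : Fin (k + 1) → Y) ∈ facialReductionCone (k + 1) K := by
  intro i
  refine Fin.lastCases ?_ (fun i => ?_) i
  · rw [Fin.snoc_last, Fin.val_last, cutFace_snoc _ _ _ le_rfl]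
    exact hw
  · rw [Fin.snoc_castSucc, Fin.val_castSucc, cutFace_snoc _ _ _ i.2.le]
    exact hy i

lemma IsFacialReduction.mem_facialReductionCone {H : AffineSubspace ℝ Y} {K : Set Y} {k : ℕ}
    {y : Fin k → Y} (hy : IsFacialReduction H K y) : y ∈ facialReductionCone k K :=
  fun i => (hy i).2.1

/-- Each step of the facial reduction algorithm lowers the dimension of the current face, which
bounds the number of steps. -/
lemma IsFacialReduction.add_finrank_le {H : AffineSubspace ℝ Y} {K : Set Y} {k : ℕ}
    {y : Fin k → Y} (hy : IsFacialReduction H K y) {i : ℕ} (hi : i ≤ k) :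
    i + Module.finrank ℝ (Submodule.span ℝ (cutFace K y i)) ≤ Module.finrank ℝ Y := by
  induction i with
  | zero => simpa using Submodule.finrank_le _
  | succ i ih =>
    have hlt : Submodule.span ℝ (cutFace K y (i + 1)) < Submodule.span ℝ (cutFace K y i) := by
      refine lt_of_le_of_ne (Submodule.span_mono fun x hx =>
        ((mem_cutFace_succ hi).1 hx).1) fun heq => (hy ⟨i, hi⟩).2.2 ?_
      change y ⟨i, hi⟩ ∈ (Submodule.span ℝ (cutFace K y i))ᗮ
      rw [← heq, mem_orthogonal_span]
      intro x hx
      rw [real_inner_comm]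
      exact ((mem_cutFace_succ hi).1 hx).2
    have := Submodule.finrank_lt_finrank_of_lt hlt
    have := ih (by omega)
    omega

/-- The facial reduction algorithm for a linear subspace reaches the minimal cone: as long as the
current face is too large, the theorem of the alternative provides another step, and the number of
steps is bounded by the dimension. -/
lemma exists_isFacialReduction_cutFace_eq {K : ProperCone ℝ Y} {R : Submodule ℝ Y} {z : Y}
    (hz : z ∈ intrinsicInterior ℝ ((R : Set Y) ∩ (K : Set Y))) :
    ∃ k, ∃ y : Fin k → Y, IsFacialReduction R.toAffineSubspace (K : Set Y) y ∧
      cutFace (K : Set Y) y k = minimalCone R.toAffineSubspace (K : Set Y) := by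
  by_contra! hcon
  have hzRK : z ∈ (R : Set Y) ∩ (K : Set Y) := intrinsicInterior_subset hz
  have hspan : Submodule.span ℝ ((R.toAffineSubspace : AffineSubspace ℝ Y) : Set Y) = R :=
    Submodule.span_eq R
  have hlong : ∀ k, ∃ y : Fin k → Y, IsFacialReduction R.toAffineSubspace (K : Set Y) y := by
    intro k
    induction k with
    | zero => exact ⟨Fin.elim0, fun i => i.elim0⟩
    | succ k ih =>
      obtain ⟨y, hy⟩ := ih
      have hne := hcon k y hy
      rw [minimalCone_eq_generatedFace hz] at hne
      have hex : ∃ w ∈ Rᗮ, w ∈ ProperCone.innerDual (cutFace (K : Set Y) y k) ∧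
          w ∉ (Submodule.span ℝ (cutFace (K : Set Y) y k))ᗮ := by
        by_contra! hno
        refine hne (Set.Subset.antisymm (fun x hx => ?_) ?_)
        · obtain ⟨f, hf, hxf⟩ := exists_add_mem_of_orthogonal R (cutCone K y k)
            (fun w hw hwC => mem_orthogonal_span.1 (hno w hw fun x hx => hwC x hx)) (x := x) hx
          exact mem_generatedFace_of_add_mem hx.1 hf.1
            (subset_generatedFace Set.inter_subset_right hz ⟨hxf, K.add_mem hx.1 hf.1⟩)
        · refine (isFace_cutFace hy.mem_facialReductionCone le_rfl).generatedFace_subset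
            ⟨hzRK.2, fun j _ => ?_⟩
          have := (hy j).1
          rw [hspan] at this
          exact Submodule.inner_left_of_mem_orthogonal hzRK.1 this
      obtain ⟨w, hwR, hw, hw'⟩ := hex
      refine ⟨Fin.snoc y w, fun i => ?_⟩
      refine Fin.lastCases ?_ (fun i => ?_) i
      · rw [Fin.snoc_last, Fin.val_last, cutFace_snoc _ _ _ le_rfl, hspan]
        exact ⟨hwR, hw, hw'⟩
      · rw [Fin.snoc_castSucc, Fin.val_castSucc, cutFace_snoc _ _ _ i.2.le]
        exact hy i
  obtain ⟨y, hy⟩ := hlong (Module.finrank ℝ Y + 1)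
  have := hy.add_finrank_le le_rfl
  omega

/-- The infimum defining the singularity degree is attained, so it is not the junk value of an
empty set. -/
lemma exists_isFacialReduction_singularityDegree {K : ProperCone ℝ Y} {R : Submodule ℝ Y} {z : Y}
    (hz : z ∈ intrinsicInterior ℝ ((R : Set Y) ∩ (K : Set Y))) :
    ∃ y : Fin (singularityDegree R.toAffineSubspace (K : Set Y)) → Y,
      IsFacialReduction R.toAffineSubspace (K : Set Y) y ∧
      cutFace (K : Set Y) y (singularityDegree R.toAffineSubspace (K : Set Y)) =
        generatedFace K z := by
  rw [← minimalCone_eq_generatedFace (H := R.toAffineSubspace) hz]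
  exact Nat.sInf_mem (s := {k | ∃ y : Fin k → Y,
    IsFacialReduction R.toAffineSubspace (K : Set Y) y ∧
      cutFace (K : Set Y) y k = minimalCone R.toAffineSubspace (K : Set Y)})
    (exists_isFacialReduction_cutFace_eq hz)

lemma pair_mem_facialReductionCone {K : Set Y} {a b : Y} (ha : a ∈ ProperCone.innerDual K)
    (hb : ∀ x ∈ K, ⟪a, x⟫_ℝ = 0 → 0 ≤ ⟪x, b⟫_ℝ) :
    (![a, b] : Fin (1 + 1) → Y) ∈ facialReductionCone (1 + 1) K := by
  intro i
  fin_cases i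
  · change a ∈ ProperCone.innerDual (cutFace K ![a, b] 0)
    rwa [cutFace_zero]
  · intro x hx
    exact hb x hx.1 (hx.2 0 (by simp))

/-! ### Nonclosedness of images and sums -/

/-- A closed image `A^* K^*` contains `A^* w` for every `w` that is nonnegative on
`R(A) ∩ K`. -/
lemma mem_image_of_isClosed {E : Type*} [NormedAddCommGroup E] [InnerProductSpace ℝ E]
    [FiniteDimensional ℝ E] {K : ProperCone ℝ Y} {A : E →ₗ[ℝ] Y}
    (hcl : IsClosed (LinearMap.adjoint A '' (ProperCone.innerDual (K : Set Y) : Set Y))) {w : Y}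
    (hw : ∀ x, A x ∈ K → 0 ≤ ⟪A x, w⟫_ℝ) :
    LinearMap.adjoint A w ∈ LinearMap.adjoint A '' (ProperCone.innerDual (K : Set Y) : Set Y) := by
  by_contra hnot
  let C : ProperCone ℝ E :=
    ⟨PointedCone.map (LinearMap.adjoint A) (ProperCone.innerDual (K : Set Y)).toPointedCone, hcl⟩
  obtain ⟨x, hx, hxw⟩ := C.hyperplane_separation' hnot
  rw [LinearMap.adjoint_inner_left, real_inner_comm] at hxw
  refine absurd (hw x ?_) (not_le.2 hxw)
  rw [← ProperCone.innerDual_innerDual K]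
  intro u hu
  have := hx _ (Set.mem_image_of_mem (LinearMap.adjoint A) hu)
  rwa [LinearMap.adjoint_inner_left] at this

/-- A closed sum `K^* + S^⊥` contains every `w` that is nonnegative on `K ∩ S`. -/
lemma mem_add_orthogonal_of_isClosed {K : ProperCone ℝ Y} {S : Submodule ℝ Y}
    (hcl : IsClosed ((ProperCone.innerDual (K : Set Y) : Set Y) + (Sᗮ : Set Y))) {w : Y}
    (hw : ∀ x ∈ K, x ∈ S → 0 ≤ ⟪x, w⟫_ℝ) :
    w ∈ (ProperCone.innerDual (K : Set Y) : Set Y) + (Sᗮ : Set Y) := by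
  by_contra hnot
  let P : PointedCone ℝ Y :=
    (ProperCone.innerDual (K : Set Y)).toPointedCone ⊔ ((Sᗮ : Submodule ℝ Y) : PointedCone ℝ Y)
  have hP : (P : Set Y) = (ProperCone.innerDual (K : Set Y) : Set Y) + (Sᗮ : Set Y) :=
    Submodule.coe_sup _ _
  let C : ProperCone ℝ Y := ⟨P, by change IsClosed (P : Set Y); rwa [hP]⟩
  have hnotC : w ∉ C := fun h => hnot (hP ▸ h)
  obtain ⟨x, hx, hxw⟩ := C.hyperplane_separation' hnotC
  rw [real_inner_comm] at hxw
  refine absurd (hw x ?_ ?_) (not_le.2 hxw)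
  · rw [← ProperCone.innerDual_innerDual K]
    intro u hu
    have hu' : u ∈ (ProperCone.innerDual (K : Set Y)).toPointedCone := hu
    exact hx u (Submodule.mem_sup_left hu')
  · rw [← Submodule.orthogonal_orthogonal S, Submodule.mem_orthogonal]
    intro u hu
    have h1 := hx u (Submodule.mem_sup_right hu)
    have h2 := hx (-u) (Submodule.mem_sup_right (Submodule.neg_mem _ hu))
    rw [inner_neg_left] at h2
    linarith

lemma not_isClosed_image_and_hasImageNonclosedProof {m : ℕ} {K : ProperCone ℝ Y}
    {A : EuclideanSpace ℝ (Fin m) →ₗ[ℝ] Y} {v z : Y}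
    (hz : z ∈ intrinsicInterior ℝ ((LinearMap.range A : Set Y) ∩ (K : Set Y)))
    (hvA : v ∈ LinearMap.range A)
    (hvcl : v ∈ closure (feasibleDirections z (K : Set Y)))
    (hvdir : v ∉ feasibleDirections z (K : Set Y)) :
    ¬ IsClosed (LinearMap.adjoint A '' (ProperCone.innerDual (K : Set Y) : Set Y)) ∧
      HasImageNonclosedProof A (K : Set Y) 1
        (singularityDegree (LinearMap.range A).toAffineSubspace (K : Set Y)) := by
  have hzRK : z ∈ (LinearMap.range A : Set Y) ∩ (K : Set Y) := intrinsicInterior_subset hz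
  have hvspan : v ∉ Submodule.span ℝ (generatedFace K z : Set Y) :=
    fun h => hvdir (mem_feasibleDirections_of_mem_span hzRK.2 h)
  obtain ⟨w, hw, hvw⟩ := exists_orthogonal_inner_eq_neg_one hvspan
  rw [mem_orthogonal_span] at hw
  have hzw : ⟪z, w⟫_ℝ = 0 := hw z (self_mem_generatedFace hzRK.2)
  have hvdual : ∀ u ∈ ProperCone.innerDual (K : Set Y), ⟪z, u⟫_ℝ = 0 → 0 ≤ ⟪v, u⟫_ℝ :=
    fun u hu huz => inner_nonneg_of_mem_closure_feasibleDirections hvcl (fun x hx => hu hx) huz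
  refine ⟨fun hcl => ?_, ?_⟩
  · obtain ⟨u, hu, huw⟩ := mem_image_of_isClosed hcl (w := w) fun x hx =>
      (hw _ (subset_generatedFace Set.inter_subset_right hz ⟨⟨x, rfl⟩, hx⟩)).ge
    have hrange : ∀ a ∈ LinearMap.range A, ⟪a, u⟫_ℝ = ⟪a, w⟫_ℝ := by
      rintro _ ⟨x, rfl⟩
      rw [← LinearMap.adjoint_inner_right, huw, LinearMap.adjoint_inner_right]
    have := hvdual u hu ((hrange z hzRK.1).trans hzw)
    rw [hrange v hvA, hvw] at this
    linarith
  · obtain ⟨y, hy, hymin⟩ := exists_isFacialReduction_singularityDegree hz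
    generalize singularityDegree (LinearMap.range A).toAffineSubspace (K : Set Y) = l
      at y hy hymin ⊢
    refine ⟨le_rfl, Nat.one_le_iff_ne_zero.2 ?_, ![z, v],
      pair_mem_facialReductionCone (fun u hu => ?_) (fun u hu huz => ?_), Fin.snoc y w,
      snoc_mem_facialReductionCone hy.mem_facialReductionCone (fun x hx => ?_),
      ?_, fun j => ?_, ?_, ?_⟩
    · -- In degree zero the minimal cone would be `K`, whose span contains all directions.
      rintro rfl
      rw [cutFace_zero] at hymin
      refine hvspan (closure_minimal (t := (Submodule.span ℝ (generatedFace K z : Set Y) : Set Y))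
        ?_ (Submodule.closed_of_finiteDimensional _) hvcl)
      rintro d ⟨ε, hε, hd⟩
      rw [hymin] at hd
      have h1 := Submodule.sub_mem _ (Submodule.subset_span hd)
        (Submodule.subset_span (R := ℝ) (self_mem_generatedFace hzRK.2))
      rw [add_sub_cancel_left] at h1
      exact (Submodule.smul_mem_iff _ hε.ne').1 h1
    · rw [innerₗ_apply_apply, real_inner_comm]
      exact hu hzRK.2
    · rw [real_inner_comm]
      exact hvdual u hu huz
    · rw [hymin] at hx
      exact (hw x hx).ge
    · intro i
      fin_cases i
      · exact hzRK.1
      · exact hvA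
    · rw [Fin.snoc_castSucc]
      have h := (hy j).1
      rw [mem_orthogonal_span] at h
      rw [LinearMap.mem_ker, ← inner_self_eq_zero (𝕜 := ℝ), LinearMap.adjoint_inner_right]
      exact h _ ⟨_, rfl⟩
    · intro i
      fin_cases i
      rw [Fin.snoc_last]
      exact hzw
    · rw [Fin.snoc_last]
      exact hvw

/-! ### Nonexposed faces -/

/-- The smallest exposed face containing `g ∈ K` is cut out by a vector in the relative interior
of `K^* ∩ g^⊥`; every vector of `K^* ∩ g^⊥` vanishes on it. -/
lemma exists_exposing_vector (K : ProperCone ℝ Y) (g : Y) :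
    ∃ y ∈ ProperCone.innerDual (K : Set Y), ⟪g, y⟫_ℝ = 0 ∧
      ∀ u ∈ ProperCone.innerDual (K : Set Y), ⟪g, u⟫_ℝ = 0 →
        ∀ x ∈ K, ⟪y, x⟫_ℝ = 0 → ⟪u, x⟫_ℝ = 0 := by
  set N : Set Y := {u | u ∈ ProperCone.innerDual (K : Set Y) ∧ ⟪g, u⟫_ℝ = 0} with hN
  have hNconv : Convex ℝ N := by
    refine (ProperCone.convex _).inter ?_
    have := (LinearMap.ker (innerₗ Y g)).convex
    exact this
  obtain ⟨y, hy⟩ := Set.Nonempty.intrinsicInterior hNconv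
    ⟨0, Submodule.zero_mem _, inner_zero_right _⟩
  have hyN : y ∈ N := intrinsicInterior_subset hy
  refine ⟨y, hyN.1, hyN.2, fun u hu hgu x hx hyx => ?_⟩
  obtain ⟨ε, hε, h⟩ := exists_add_smul_sub_mem hy (show u ∈ N from ⟨hu, hgu⟩)
  have h1 : 0 ≤ ⟪x, u⟫_ℝ := hu hx
  have h2 : 0 ≤ ⟪x, y + ε • (y - u)⟫_ℝ := h.1 hx
  rw [real_inner_comm] at hyx
  rw [inner_add_right, inner_smul_right, inner_sub_right, hyx] at h2
  rw [real_inner_comm]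
  nlinarith

lemma isFace_inter_orthogonal {K : ProperCone ℝ Y} {y : Y}
    (hy : y ∈ ProperCone.innerDual (K : Set Y)) :
    IsFace {x | x ∈ (K : Set Y) ∧ ⟪y, x⟫_ℝ = 0} (K : Set Y) := by
  have hy' : (fun _ : Fin 1 => y) ∈ facialReductionCone 1 (K : Set Y) := by
    intro i
    fin_cases i
    change y ∈ ProperCone.innerDual (cutFace _ _ 0)
    rwa [cutFace_zero]
  convert isFace_cutFace hy' le_rfl using 1
  ext x
  simp [cutFace]

/-- A nonexposed face `G` is strictly smaller than the smallest exposed face containing it, so a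
facial reduction step for `ℝg`, `g` in the relative interior of `G`, is available in that exposed
face. -/
lemma exists_isLeast_exposedFace_and_hasSumNonclosedProof {K : ProperCone ℝ Y} {G : Set Y}
    (hG : IsFace G (K : Set Y)) (hne : G.Nonempty) (hexp : ¬ IsExposedFace G (K : Set Y)) :
    ∃ F : Set Y, IsLeast {E : Set Y | IsExposedFace E (K : Set Y) ∧ G ⊆ E} F ∧
      ¬ IsClosed ((ProperCone.innerDual (K : Set Y) : Set Y) + ((Submodule.span ℝ F)ᗮ : Set Y)) ∧
      HasSumNonclosedProof F (K : Set Y) 1 1 := by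
  obtain ⟨g, hgri⟩ := Set.Nonempty.intrinsicInterior hG.convex hne
  have hgG : g ∈ G := intrinsicInterior_subset hgri
  have hgK : g ∈ K := hG.subset hgG
  have hGgen : G = generatedFace K g :=
    (subset_generatedFace hG.subset hgri).antisymm (hG.generatedFace_subset hgG)
  obtain ⟨y, hy, hgy, hymax⟩ := exists_exposing_vector K g
  let F : PointedCone ℝ Y := cutCone K (fun _ : Fin 1 => y) 1
  have hF : ∀ {x}, x ∈ F ↔ x ∈ K ∧ ⟪y, x⟫_ℝ = 0 := fun {x} => by
    change x ∈ cutFace _ _ _ ↔ _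
    simp [cutFace]
  have hFset : (F : Set Y) = {x | x ∈ (K : Set Y) ∧ ⟪y, x⟫_ℝ = 0} := Set.ext fun _ => hF
  have hFface : IsFace (F : Set Y) (K : Set Y) := hFset ▸ isFace_inter_orthogonal hy
  have hgF : g ∈ F := hF.2 ⟨hgK, by rwa [real_inner_comm]⟩
  have hGF : G ⊆ F := hGgen ▸ hFface.generatedFace_subset hgF
  have hFexp : IsExposedFace (F : Set Y) (K : Set Y) := ⟨hFface, y, hy, hFset⟩
  have hyspan : ∀ x ∈ Submodule.span ℝ (F : Set Y), ⟪y, x⟫_ℝ = 0 := by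
    have : y ∈ (Submodule.span ℝ (F : Set Y))ᗮ := mem_orthogonal_span.2 fun x hx => by
      rw [real_inner_comm]
      exact (hF.1 hx).2
    exact fun x hx => Submodule.inner_left_of_mem_orthogonal hx this
  have hex : ∃ w, ⟪g, w⟫_ℝ = 0 ∧ (∀ x ∈ F, 0 ≤ ⟪x, w⟫_ℝ) ∧ ∃ x ∈ F, ⟪x, w⟫_ℝ ≠ 0 := by
    by_contra! hno
    refine hexp ?_
    have hFG : (F : Set Y) ⊆ G := by
      intro x hx
      obtain ⟨f, hf, hxf⟩ := exists_add_mem_of_orthogonal (Submodule.span ℝ {g}) F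
        (fun w hw hwF => hno w (Submodule.mem_orthogonal_singleton_iff_inner_right.1 hw) hwF) hx
      obtain ⟨s, hs⟩ := Submodule.mem_span_singleton.1 hxf
      have hxK := (hF.1 hx).1
      have hfK := (hF.1 hf).1
      rw [hGgen]
      refine ⟨hxK, |s|, abs_nonneg s, ?_⟩
      have h1 : |s| • g - x = (|s| - s) • g + f := by
        rw [sub_smul, hs]; abel
      rw [h1]
      exact K.add_mem (K.smul_mem hgK (sub_nonneg.2 (le_abs_self s))) hfK
    rwa [← hFG.antisymm hGF]
  obtain ⟨w, hgw, hwF, x, hxF, hxw⟩ := hex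
  have hxdual : ∀ u ∈ ProperCone.innerDual (K : Set Y), ⟪g, u⟫_ℝ = 0 → ⟪u, x⟫_ℝ = 0 :=
    fun u hu hgu => hymax u hu hgu x (hF.1 hxF).1 (hF.1 hxF).2
  refine ⟨F, ⟨⟨hFexp, hGF⟩, ?_⟩, fun hcl => ?_, le_rfl, le_rfl,
    ![g, (-(⟪x, w⟫_ℝ)⁻¹) • x], pair_mem_facialReductionCone (fun u hu => ?_)
      (fun u hu hgu => ?_), ![y, w], pair_mem_facialReductionCone hy
      (fun x hx hyx => hwF x (hF.2 ⟨hx, hyx⟩)), ?_, ?_, ?_, ?_⟩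
  · rintro E ⟨⟨_, u, hu, rfl⟩, hGE⟩ p hp
    have hgu : ⟪g, u⟫_ℝ = 0 := by
      rw [real_inner_comm]
      exact (hGE hgG).2
    exact ⟨(hF.1 hp).1, hymax u hu hgu p (hF.1 hp).1 (hF.1 hp).2⟩
  · obtain ⟨u, hu, p, hp, rfl⟩ := Set.mem_add.1 (mem_add_orthogonal_of_isClosed hcl (w := w)
      fun x hx hxS => hwF x (hF.2 ⟨hx, hyspan x hxS⟩))
    have hp' : ∀ x ∈ F, ⟪x, p⟫_ℝ = 0 := mem_orthogonal_span.1 hp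
    rw [inner_add_right, hp' g hgF, add_zero] at hgw
    rw [inner_add_right, hp' x hxF, add_zero, real_inner_comm] at hxw
    exact hxw (hxdual u hu hgw)
  · rw [innerₗ_apply_apply, real_inner_comm]
    exact hu hgK
  · rw [inner_smul_right, hxdual u hu hgu, mul_zero]
  · intro i
    fin_cases i
    · exact Submodule.subset_span hgF
    · exact Submodule.smul_mem _ _ (Submodule.subset_span hxF)
  · intro i
    fin_cases i
    rw [Submodule.mem_orthogonal']
    exact hyspan
  · intro i
    fin_cases i
    exact hgw
  · change ⟪(-(⟪x, w⟫_ℝ)⁻¹) • x, w⟫_ℝ = -1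
    rw [real_inner_smul_left]
    field_simp

end ConicLP

theorem theorem7 {Y : Type*} [NormedAddCommGroup Y] [InnerProductSpace ℝ Y]
    [FiniteDimensional ℝ Y] (K : ProperCone ℝ Y) :
    (∀ (m : ℕ) (A : EuclideanSpace ℝ (Fin m) →ₗ[ℝ] Y) (z : Y),
      z ∈ intrinsicInterior ℝ ((LinearMap.range A : Set Y) ∩ (K : Set Y)) →
      ¬ ((LinearMap.range A : Set Y) ∩
          (closure (ConicLP.feasibleDirections z (K : Set Y)) \
            ConicLP.feasibleDirections z (K : Set Y)) = ∅) →
      ¬ IsClosed (LinearMap.adjoint A '' (ProperCone.innerDual (K : Set Y) : Set Y)) ∧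
      ConicLP.HasImageNonclosedProof A (K : Set Y) 1
        (ConicLP.singularityDegree (LinearMap.range A).toAffineSubspace (K : Set Y))) ∧
    (∀ G : Set Y, ConicLP.IsFace G (K : Set Y) → G.Nonempty →
      ¬ ConicLP.IsExposedFace G (K : Set Y) →
      ∃ F : Set Y, IsLeast {E : Set Y | ConicLP.IsExposedFace E (K : Set Y) ∧ G ⊆ E} F ∧
        ¬ IsClosed ((ProperCone.innerDual (K : Set Y) : Set Y) +
          ((Submodule.span ℝ F)ᗮ : Set Y)) ∧
        ConicLP.HasSumNonclosedProof F (K : Set Y) 1 1) := by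
  refine ⟨fun m A z hz hviol => ?_, fun G hG hne hexp =>
    ConicLP.exists_isLeast_exposedFace_and_hasSumNonclosedProof hG hne hexp⟩
  obtain ⟨v, hvA, hvcl, hvdir⟩ := Set.nonempty_iff_ne_empty.2 hviol
  exact ConicLP.not_isClosed_image_and_hasImageNonclosedProof hz hvA hvcl hvdir
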